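/- Let $n\ge 1$, let $a_1,\dots,a_m\in\mathbb R^n$ and $b_1,\dots,b_m\in\mathbb R$, and suppose that the polytope $K=\{x\in\mathbb R^n : a_i^\top x\ge b_i \text{ for } i=1,\dots,m\}$ is bounded and has non-empty interior. For $x\in\operatorname{int}K$ let \[ H(x)=\sum_{i=1}^m \frac{a_i a_i^\top}{(a_i^\top x-b_i)^2},\qquad \|v\|_x=\sqrt{v^\top H(x)v}\quad(v\in\mathbb R^n), \] be the Hessian of the log-barrier $-\sum_{i}\log(a_i^\top x-b_i)$ and the local norm at $x$ (terms with $a_i=0$ are read as $0$). For $r>0$ let $g_x$ be the Gaussian distribution on $\mathbb R^n$ with mean $x$ and covariance matrix $\frac{r^2}{n}H(x)^{-1}$. Then for every $\varepsilon\in(0,\tfrac12]$, every $r$ with $0<r\le\frac{\varepsilon}{20}\left(\log\frac{11}{\varepsilon}\right)^{-3/2}$ and every $x\in\operatorname{int}K$, \[ \Pr_{z\sim g_x}\left[\, z\in\operatorname{int}K \ \text{ and }\ \|z-x\|_z^2-\|z-x\|_x^2\le 2\varepsilon\cdot\frac{r^2}{n}\,\right]\ \ge\ 1-\varepsilon. \]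 -/

import Mathlib

open MeasureTheory ProbabilityTheory

noncomputable section

namespace DikinWalk

/-- The set of points of `ℝⁿ` satisfying the inequalities `aᵢᵀ x ≥ bᵢ`, `i ∈ [m]`. -/
def polytope {m n : ℕ} (a : Fin m → EuclideanSpace ℝ (Fin n)) (b : Fin m → ℝ) :
    Set (EuclideanSpace ℝ (Fin n)) :=
  {x | ∀ i, b i ≤ inner ℝ (a i) x}

/-- The Hessian of the log-barrier `x ↦ -∑ᵢ log (aᵢᵀ x - bᵢ)`, namely
`H(x) = ∑ᵢ (aᵢᵀ x - bᵢ)⁻² aᵢ aᵢᵀ`. -/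
def barrierHessian {m n : ℕ} (a : Fin m → EuclideanSpace ℝ (Fin n)) (b : Fin m → ℝ)
    (x : EuclideanSpace ℝ (Fin n)) : Matrix (Fin n) (Fin n) ℝ :=
  ∑ i, (1 / (inner ℝ (a i) x - b i) ^ 2) • Matrix.vecMulVec (a i).ofLp (a i).ofLp

/-- The local norm `‖v‖ₓ = √(vᵀ H(x) v)`. -/
def localNorm {m n : ℕ} (a : Fin m → EuclideanSpace ℝ (Fin n)) (b : Fin m → ℝ)
    (x v : EuclideanSpace ℝ (Fin n)) : ℝ :=
  Real.sqrt (v.ofLp ⬝ᵥ (barrierHessian a b x).mulVec v.ofLp)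

/-- The proposal distribution `gₓ` of the Gaussian Dikin walk: the Gaussian distribution with
mean `x` and covariance matrix `(r² / n) H(x)⁻¹`. -/
def proposal {m n : ℕ} (a : Fin m → EuclideanSpace ℝ (Fin n)) (b : Fin m → ℝ) (r : ℝ)
    (x : EuclideanSpace ℝ (Fin n)) : Measure (EuclideanSpace ℝ (Fin n)) :=
  multivariateGaussian x ((r ^ 2 / (n : ℝ)) • (barrierHessian a b x)⁻¹)

end DikinWalk

end

/-!
Write the proposal as `z = x + w` with `w = (r / √n) H(x)^(-1/2) g` for a standard Gaussian `g`,
and let `dᵢ = aᵢᵀ w / (aᵢᵀ x - bᵢ)` be the relative change of the `i`-th slack. As long as every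
`|dᵢ|` is at most `1/10`, the point `z` stays in the interior, and
`‖w‖_z² - ‖w‖_x² = ∑ᵢ (dᵢ² / (1 + dᵢ)² - dᵢ²) ≤ -2 ∑ᵢ dᵢ³ + 4 ∑ᵢ dᵢ⁴`.
The definition of `H` says exactly that `dᵢ = (r / √n) ⟪cᵢ, g⟫` for a Parseval frame `c` of `ℝⁿ`,
so it remains to show that the cubic form `∑ᵢ ⟪cᵢ, g⟫³` is of order `√n` and the quartic form
`∑ᵢ ⟪cᵢ, g⟫⁴` of order `n`, up to powers of `log (1/ε)`, with probability `1 - ε`.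

Both follow from Markov's inequality applied to a moment of order about `log (1/ε)`. Minkowski's
inequality and the one-dimensional Gaussian moments bound the moments of the quartic form. They
are too crude for the cubic form, whose smaller size is due to cancellation. A rotation of two
independent Gaussians `g`, `g'` reduces it to the polarized form `∑ᵢ ⟪cᵢ, g⟫² ⟪cᵢ, g'⟫`, which is
linear in `g'`: given `g` it is Gaussian, and its variance is at most `∑ᵢ ⟪cᵢ, g⟫⁴` by the frame
property.
-/

namespace DikinWalk

open scoped Nat NNReal ENNReal RealInnerProductSpace Matrix MatrixOrder

/-! ### Moments of Gaussian linear forms -/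

lemma doubleFactorial_two_mul_sub_one_le (k : ℕ) : (2 * k - 1)‼ ≤ k ^ k := by
  cases k with
  | zero => simp
  | succ k =>
    have hsplit : (2 * (k + 1))! = (2 * (k + 1))‼ * (2 * (k + 1) - 1)‼ :=
      Nat.factorial_eq_mul_doubleFactorial (2 * k + 1)
    refine le_of_mul_le_mul_left (a := 2 ^ (k + 1) * (k + 1)!) ?_ (by positivity)
    calc 2 ^ (k + 1) * (k + 1)! * (2 * (k + 1) - 1)‼ = (2 * (k + 1))! := by
          rw [hsplit, Nat.doubleFactorial_two_mul]
      _ ≤ (2 * (k + 1)) ^ (k + 1) * (k + 1)! := Nat.factorial_two_mul_le (k + 1)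
      _ = 2 ^ (k + 1) * (k + 1)! * (k + 1) ^ (k + 1) := by rw [mul_pow]; ring

lemma integral_even_pow_gaussianReal (k : ℕ) :
    ∫ x, x ^ (2 * k) ∂(gaussianReal 0 1) = ((2 * k - 1 : ℕ)‼ : ℝ) := by
  have hdensity (x : ℝ) : gaussianPDFReal 0 1 x • x ^ (2 * k) =
      (√(2 * Real.pi))⁻¹ * (|x| ^ (2 * k) * Real.exp (-(1 / 2) * |x| ^ 2)) := by
    simp only [gaussianPDFReal, NNReal.coe_one, mul_one, sub_zero, smul_eq_mul, sq_abs,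
      (even_two_mul k).pow_abs]
    ring_nf
  have hGamma := integral_rpow_mul_exp_neg_mul_rpow (p := 2) (q := (2 * k : ℕ)) (b := 1 / 2)
    (by norm_num) (by linarith [(2 * k).cast_nonneg (α := ℝ)]) (by norm_num)
  have harg : (((2 * k : ℕ) : ℝ) + 1) / 2 = k + 1 / 2 := by push_cast; ring
  have hpi : √Real.pi ≠ 0 := by positivity
  simp only [Real.rpow_natCast, Real.rpow_two] at hGamma
  simp_rw [integral_gaussianReal_eq_integral_smul one_ne_zero, hdensity]
  rw [integral_comp_abs (f := fun y : ℝ => (√(2 * Real.pi))⁻¹ *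
    (y ^ (2 * k) * Real.exp (-(1 / 2) * y ^ 2))), integral_const_mul, hGamma, harg,
    Real.Gamma_nat_add_half, neg_div, harg, one_div, Real.inv_rpow (by norm_num),
    Real.rpow_neg (by norm_num), inv_inv, Real.rpow_add (by norm_num), Real.rpow_natCast,
    ← one_div (2 : ℝ), ← Real.sqrt_eq_rpow, Real.sqrt_mul (by norm_num)]
  field_simp

section Lp

variable {α R : Type*} {mα : MeasurableSpace α} {μ : Measure α}

lemma eLpNorm_pow [NormedDivisionRing R] (f : α → R) (p : ℝ≥0∞) {q : ℕ} (hq : q ≠ 0) :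
    eLpNorm (fun x => f x ^ q) p μ = eLpNorm f (q * p) μ ^ q := by
  have h := eLpNorm_norm_rpow (p := p) (μ := μ) f (q := q) (by positivity)
  rw [ENNReal.rpow_natCast, ENNReal.ofReal_natCast, mul_comm] at h
  rw [← h, ← eLpNorm_norm]
  simp only [norm_pow, Real.rpow_natCast]

lemma eLpNorm_natCast_pow_eq_lintegral [NormedAddCommGroup R] (f : α → R) {p : ℕ} (hp : p ≠ 0) :
    eLpNorm f p μ ^ p = ∫⁻ x, ‖f x‖ₑ ^ p ∂μ := by
  have h := eLpNorm_nnreal_pow_eq_lintegral (f := f) (μ := μ) (p := (p : NNReal))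
    (by exact_mod_cast hp)
  simpa only [NNReal.coe_natCast, ENNReal.rpow_natCast, ENNReal.coe_natCast] using h

end Lp

lemma eLpNorm_id_gaussianReal_sq_le {k : ℕ} (hk : k ≠ 0) :
    eLpNorm id (2 * k) (gaussianReal 0 1) ^ 2 ≤ k := by
  have hint : Integrable (fun x : ℝ => x ^ (2 * k)) (gaussianReal 0 1) :=
    integrable_pow_of_mem_interior_integrableExpSet (X := id) (by simp) (2 * k)
  refine (ENNReal.pow_le_pow_left_iff hk).1 ?_
  calc (eLpNorm id (2 * k) (gaussianReal 0 1) ^ 2) ^ k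
      = eLpNorm id (2 * k : ℕ) (gaussianReal 0 1) ^ (2 * k) := by rw [pow_mul]; push_cast; rfl
    _ = ∫⁻ x, ENNReal.ofReal (x ^ (2 * k)) ∂(gaussianReal 0 1) := by
        rw [eLpNorm_natCast_pow_eq_lintegral _ (by positivity)]
        simp only [id_eq, Real.enorm_eq_ofReal_abs, ← ENNReal.ofReal_pow (abs_nonneg _),
          (even_two_mul k).pow_abs]
    _ = ((2 * k - 1 : ℕ)‼ : ℝ≥0∞) := by
        rw [← ofReal_integral_eq_lintegral_ofReal hint
          (.of_forall fun x => (even_two_mul k).pow_nonneg x),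
          integral_even_pow_gaussianReal, ENNReal.ofReal_natCast]
    _ ≤ (k : ℝ≥0∞) ^ k := by exact_mod_cast doubleFactorial_two_mul_sub_one_le k

section Gaussian

variable {E : Type*} [NormedAddCommGroup E] [InnerProductSpace ℝ E] [FiniteDimensional ℝ E]
  [MeasurableSpace E] [BorelSpace E]

lemma stdGaussian_map_inner (v : E) :
    (stdGaussian E).map (⟪v, ·⟫) = (gaussianReal 0 1).map (‖v‖ * ·) := by
  have h := IsGaussian.map_eq_gaussianReal (μ := stdGaussian E) (innerSL ℝ v)
  rw [variance_dual_stdGaussian, integral_strongDual_stdGaussian, innerSL_apply_norm] at h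
  rw [gaussianReal_map_const_mul, mul_zero, mul_one]
  convert h using 2
  · ext x; simp
  · rw [← NNReal.coe_inj]; simp

lemma eLpNorm_inner_stdGaussian (v : E) (p : ℝ≥0∞) :
    eLpNorm (⟪v, ·⟫) p (stdGaussian E) = ‖v‖ₑ * eLpNorm id p (gaussianReal 0 1) := by
  calc eLpNorm (⟪v, ·⟫) p (stdGaussian E)
      = eLpNorm id p ((stdGaussian E).map (⟪v, ·⟫)) :=
        (eLpNorm_map_measure aestronglyMeasurable_id (by fun_prop)).symm
    _ = eLpNorm (‖v‖ • id) p (gaussianReal 0 1) := by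
        rw [stdGaussian_map_inner, eLpNorm_map_measure aestronglyMeasurable_id (by fun_prop)]
        rfl
    _ = ‖v‖ₑ * eLpNorm id p (gaussianReal 0 1) := by rw [eLpNorm_const_smul, enorm_norm]

lemma eLpNorm_inner_stdGaussian_sq_le (v : E) {k : ℕ} (hk : k ≠ 0) :
    eLpNorm (⟪v, ·⟫) (2 * k) (stdGaussian E) ^ 2 ≤ k * ‖v‖ₑ ^ 2 := by
  rw [eLpNorm_inner_stdGaussian, mul_pow, mul_comm]
  gcongr
  exact eLpNorm_id_gaussianReal_sq_le hk

end Gaussian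

/-! ### Parseval frames -/

section Frame

variable {E ι : Type*} [NormedAddCommGroup E] [InnerProductSpace ℝ E] [Fintype ι] {c : ι → E}

/-- A finite family `c` is a Parseval frame of `E` if `∑ i, ⟪c i, v⟫ ^ 2 = ‖v‖ ^ 2` for all `v`,
that is, if `∑ i, c i (c i)ᵀ` is the identity. The slack directions of a polytope at an interior
point form such a frame in the local norm. -/
def IsParsevalFrame (c : ι → E) : Prop :=
  ∀ v, ∑ i, ⟪c i, v⟫ ^ 2 = ‖v‖ ^ 2

lemma IsParsevalFrame.norm_le_one (hc : IsParsevalFrame c) (i : ι) : ‖c i‖ ≤ 1 := by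
  have h : ‖c i‖ ^ 4 ≤ ‖c i‖ ^ 2 := by
    calc ‖c i‖ ^ 4 = ⟪c i, c i⟫ ^ 2 := by rw [real_inner_self_eq_norm_sq, ← pow_mul]
      _ ≤ ∑ j, ⟪c j, c i⟫ ^ 2 :=
        Finset.single_le_sum (f := fun j => ⟪c j, c i⟫ ^ 2) (fun j _ => sq_nonneg _)
          (Finset.mem_univ i)
      _ = ‖c i‖ ^ 2 := hc (c i)
  by_contra! hi
  exact absurd ((pow_le_pow_iff_right₀ hi).1 h) (by norm_num)

lemma IsParsevalFrame.sum_norm_sq [FiniteDimensional ℝ E] (hc : IsParsevalFrame c) :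
    ∑ i, ‖c i‖ ^ 2 = Module.finrank ℝ E := by
  simp_rw [← (stdOrthonormalBasis ℝ E).sum_sq_inner_left]
  rw [Finset.sum_comm]
  simp [hc _]

lemma IsParsevalFrame.norm_sum_smul_sq_le (hc : IsParsevalFrame c) (t : ι → ℝ) :
    ‖∑ i, t i • c i‖ ^ 2 ≤ ∑ i, t i ^ 2 := by
  set w := ∑ i, t i • c i with hw
  have hnorm : ‖w‖ ^ 2 = ∑ i, t i * ⟪c i, w⟫ := by
    rw [← real_inner_self_eq_norm_sq]
    nth_rewrite 1 [hw]
    simp only [sum_inner, real_inner_smul_left]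
  have hCauchySchwarz : ‖w‖ ^ 2 * ‖w‖ ^ 2 ≤ (∑ i, t i ^ 2) * ‖w‖ ^ 2 := by
    calc ‖w‖ ^ 2 * ‖w‖ ^ 2 = (∑ i, t i * ⟪c i, w⟫) ^ 2 := by rw [hnorm, sq]
      _ ≤ (∑ i, t i ^ 2) * ∑ i, ⟪c i, w⟫ ^ 2 := Finset.sum_mul_sq_le_sq_mul_sq _ _ _
      _ = (∑ i, t i ^ 2) * ‖w‖ ^ 2 := by rw [hc]
  rcases (sq_nonneg ‖w‖).eq_or_lt' with h0 | h0
  · exact h0 ▸ Finset.sum_nonneg fun i _ => sq_nonneg _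
  · exact le_of_mul_le_mul_right hCauchySchwarz h0

variable [FiniteDimensional ℝ E] [MeasurableSpace E] [BorelSpace E]

lemma IsParsevalFrame.eLpNorm_quartic_le (hc : IsParsevalFrame c) {k : ℕ} (hk : k ≠ 0) :
    eLpNorm (fun x => ∑ i, ⟪c i, x⟫ ^ 4) k (stdGaussian E) ≤
      4 * k ^ 2 * Module.finrank ℝ E := by
  have hterm (i : ι) :
      eLpNorm (fun x => ⟪c i, x⟫ ^ 4) k (stdGaussian E) ≤ 4 * k ^ 2 * ‖c i‖ₑ ^ 2 := by
    calc eLpNorm (fun x => ⟪c i, x⟫ ^ 4) k (stdGaussian E)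
        = (eLpNorm (⟪c i, ·⟫) (2 * (2 * k : ℕ)) (stdGaussian E) ^ 2) ^ 2 := by
          rw [eLpNorm_pow _ _ four_ne_zero, ← pow_mul]
          push_cast
          rw [← mul_assoc]
          norm_num
      _ ≤ ((2 * k : ℕ) * ‖c i‖ₑ ^ 2) ^ 2 := by
          gcongr
          exact eLpNorm_inner_stdGaussian_sq_le (c i) (by positivity)
      _ = 4 * k ^ 2 * (‖c i‖ₑ ^ 2 * ‖c i‖ₑ ^ 2) := by push_cast; ring
      _ ≤ 4 * k ^ 2 * ‖c i‖ₑ ^ 2 := by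
          gcongr
          refine mul_le_of_le_one_left' (pow_le_one' ?_ 2)
          rw [← ofReal_norm]
          exact ENNReal.ofReal_le_one.2 (hc.norm_le_one i)
  calc eLpNorm (fun x => ∑ i, ⟪c i, x⟫ ^ 4) k (stdGaussian E)
      ≤ ∑ i, eLpNorm (fun x => ⟪c i, x⟫ ^ 4) k (stdGaussian E) := by
        simpa only [Finset.sum_fn] using eLpNorm_sum_le (s := Finset.univ)
          (f := fun i x => ⟪c i, x⟫ ^ 4) (fun i _ => by fun_prop)
          (by exact_mod_cast Nat.one_le_iff_ne_zero.2 hk)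
    _ ≤ ∑ i, 4 * (k : ℝ≥0∞) ^ 2 * ‖c i‖ₑ ^ 2 := Finset.sum_le_sum fun i _ => hterm i
    _ = 4 * k ^ 2 * Module.finrank ℝ E := by
        rw [← Finset.mul_sum, ← ENNReal.ofReal_natCast (Module.finrank ℝ E), ← hc.sum_norm_sq,
          ENNReal.ofReal_sum_of_nonneg fun i _ => sq_nonneg _]
        simp_rw [ENNReal.ofReal_pow (norm_nonneg _), ofReal_norm]

lemma IsParsevalFrame.eLpNorm_polarized_cubic_sq_le (hc : IsParsevalFrame c) {k : ℕ}
    (hk : k ≠ 0) :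
    eLpNorm (fun q : E × E => ∑ i, ⟪c i, q.1⟫ ^ 2 * ⟪c i, q.2⟫) (2 * k)
        ((stdGaussian E).prod (stdGaussian E)) ^ 2 ≤
      k * eLpNorm (fun x => ∑ i, ⟪c i, x⟫ ^ 4) k (stdGaussian E) := by
  set γ := stdGaussian E
  set u : E → E := fun x => ∑ i, ⟪c i, x⟫ ^ 2 • c i with hu
  have hinner (v : E) : ∫⁻ y, ‖⟪v, y⟫‖ₑ ^ (2 * k) ∂γ ≤ k ^ k * ‖‖v‖ ^ 2‖ₑ ^ k := by
    rw [← eLpNorm_natCast_pow_eq_lintegral _ (by positivity), pow_mul, ← mul_pow, enorm_pow,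
      enorm_norm]
    gcongr
    simpa using eLpNorm_inner_stdGaussian_sq_le v hk
  refine (ENNReal.pow_le_pow_left_iff hk).1 ?_
  calc (eLpNorm (fun q : E × E => ∑ i, ⟪c i, q.1⟫ ^ 2 * ⟪c i, q.2⟫) (2 * k) (γ.prod γ) ^ 2) ^ k
      = ∫⁻ x, ∫⁻ y, ‖⟪u x, y⟫‖ₑ ^ (2 * k) ∂γ ∂γ := by
        rw [← pow_mul, ← Nat.cast_ofNat (R := ℝ≥0∞), ← Nat.cast_mul,
          eLpNorm_natCast_pow_eq_lintegral _ (by positivity), lintegral_prod _ (by fun_prop)]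
        simp only [hu, sum_inner, real_inner_smul_left]
    _ ≤ ∫⁻ x, k ^ k * ‖∑ i, ⟪c i, x⟫ ^ 4‖ₑ ^ k ∂γ := by
        refine lintegral_mono fun x => (hinner (u x)).trans ?_
        gcongr
        rw [enorm_le_iff_norm_le, Real.norm_of_nonneg (by positivity),
          Real.norm_of_nonneg (by positivity)]
        refine (hc.norm_sum_smul_sq_le _).trans_eq ?_
        simp only [← pow_mul]
    _ = (k * eLpNorm (fun x => ∑ i, ⟪c i, x⟫ ^ 4) k γ) ^ k := by
        rw [lintegral_const_mul _ (by fun_prop), mul_pow, eLpNorm_natCast_pow_eq_lintegral _ hk]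

end Frame

/-! ### Decoupling of the cubic form -/

lemma sum_inner_smul_add_smul_pow_three {E ι : Type*} [NormedAddCommGroup E]
    [InnerProductSpace ℝ E] [Fintype ι] (c : ι → E) (x y : E) :
    125 * ∑ i, ⟪c i, (3 / 5 : ℝ) • x + (4 / 5 : ℝ) • y⟫ ^ 3 =
      27 * ∑ i, ⟪c i, x⟫ ^ 3 + 64 * ∑ i, ⟪c i, y⟫ ^ 3 +
        (108 * ∑ i, ⟪c i, x⟫ ^ 2 * ⟪c i, y⟫ + 144 * ∑ i, ⟪c i, y⟫ ^ 2 * ⟪c i, x⟫) := by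
  simp only [Finset.mul_sum, ← Finset.sum_add_distrib, real_inner_smul_right, inner_add_right]
  exact Finset.sum_congr rfl fun i _ => by ring

section Cubic

variable {E ι : Type*} [NormedAddCommGroup E] [InnerProductSpace ℝ E] [Fintype ι]
  [FiniteDimensional ℝ E] [MeasurableSpace E] [BorelSpace E]

lemma measurePreserving_smul_add_smul_stdGaussian {s t : ℝ} (h : s ^ 2 + t ^ 2 = 1) :
    MeasurePreserving (fun q : E × E => s • q.1 + t • q.2)
      ((stdGaussian E).prod (stdGaussian E)) (stdGaussian E) := by
  have hnorm : ‖(⟨s, t⟩ : ℂ)‖ = 1 := by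
    rw [Complex.norm_def, Complex.normSq_mk, ← sq, ← sq, h, Real.sqrt_one]
  have hcos : Real.cos (Complex.arg ⟨s, t⟩) = s := by
    simpa [hnorm] using Complex.norm_mul_cos_arg ⟨s, t⟩
  have hsin : Real.sin (Complex.arg ⟨s, t⟩) = t := by
    simpa [hnorm] using Complex.norm_mul_sin_arg ⟨s, t⟩
  have hrot : MeasurePreserving (ContinuousLinearMap.rotation (E := E) (Complex.arg ⟨s, t⟩))
      ((stdGaussian E).prod (stdGaussian E)) ((stdGaussian E).prod (stdGaussian E)) :=
    ⟨by fun_prop, IsGaussian.map_rotation_eq_self (by simp) _⟩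
  convert measurePreserving_fst.comp hrot using 1
  ext q
  simp [ContinuousLinearMap.rotation_apply, hcos, hsin]

lemma memLp_inner_pow_stdGaussian (v : E) (q : ℕ) {p : ℝ≥0∞} (hp : p ≠ ∞) :
    MemLp (fun x => ⟪v, x⟫ ^ q) p (stdGaussian E) := by
  rcases eq_or_ne q 0 with rfl | hq
  · simpa using memLp_const (1 : ℝ)
  · refine ⟨by fun_prop, ?_⟩
    rw [eLpNorm_pow _ _ hq]
    exact ENNReal.pow_lt_top (IsGaussian.memLp_dual _ (innerSL ℝ v) _
      (ENNReal.mul_ne_top (ENNReal.natCast_ne_top q) hp)).2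

/-- Comparing the cubic form with its image under a rotation of two independent Gaussian vectors
leaves only mixed terms. The Pythagorean rotation `(3 / 5, 4 / 5)` keeps the constants rational. -/
lemma eLpNorm_cubic_le_polarized (c : ι → E) {p : ℝ≥0∞} (hp : 1 ≤ p) (hp' : p ≠ ∞) :
    34 * eLpNorm (fun x => ∑ i, ⟪c i, x⟫ ^ 3) p (stdGaussian E) ≤
      252 * eLpNorm (fun q : E × E => ∑ i, ⟪c i, q.1⟫ ^ 2 * ⟪c i, q.2⟫) p
        ((stdGaussian E).prod (stdGaussian E)) := by
  set μ := (stdGaussian E).prod (stdGaussian E)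
  set P : E → ℝ := fun x => ∑ i, ⟪c i, x⟫ ^ 3
  set R : E × E → ℝ := fun q => ∑ i, ⟪c i, q.1⟫ ^ 2 * ⟪c i, q.2⟫
  have hPm : AEStronglyMeasurable P (stdGaussian E) := by fun_prop
  have hcomp {T : E × E → E} (hT : MeasurePreserving T μ (stdGaussian E)) :
      eLpNorm (P ∘ T) p μ = eLpNorm P p (stdGaussian E) :=
    eLpNorm_comp_measurePreserving hPm hT
  have hswap : eLpNorm (R ∘ Prod.swap) p μ = eLpNorm R p μ :=
    eLpNorm_comp_measurePreserving (by fun_prop) Measure.measurePreserving_swap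
  have hexpand : (125 : ℝ) • (P ∘ fun q : E × E => (3 / 5 : ℝ) • q.1 + (4 / 5 : ℝ) • q.2) =
      ((27 : ℝ) • (P ∘ Prod.fst) + (64 : ℝ) • (P ∘ Prod.snd)) +
        ((108 : ℝ) • R + (144 : ℝ) • (R ∘ Prod.swap)) :=
    funext fun q => sum_inner_smul_add_smul_pow_three c q.1 q.2
  have hfin : eLpNorm P p (stdGaussian E) ≠ ∞ :=
    (memLp_finsetSum _ fun i _ => memLp_inner_pow_stdGaussian (c i) 3 hp').2.ne
  have hsmul (m : ℕ) [m.AtLeastTwo] (f : E × E → ℝ) :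
      eLpNorm ((ofNat(m) : ℝ) • f) p μ = ofNat(m) * eLpNorm f p μ := by
    rw [eLpNorm_const_smul, ← Nat.cast_ofNat, Real.enorm_natCast, Nat.cast_ofNat]
  refine ENNReal.le_of_add_le_add_left (a := 91 * eLpNorm P p (stdGaussian E)) (by finiteness) ?_
  calc 91 * eLpNorm P p (stdGaussian E) + 34 * eLpNorm P p (stdGaussian E)
      = eLpNorm ((125 : ℝ) •
          (P ∘ fun q : E × E => (3 / 5 : ℝ) • q.1 + (4 / 5 : ℝ) • q.2)) p μ := by
        rw [hsmul, hcomp (measurePreserving_smul_add_smul_stdGaussian (by norm_num)), ← add_mul]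
        norm_num
    _ ≤ (eLpNorm ((27 : ℝ) • (P ∘ Prod.fst)) p μ + eLpNorm ((64 : ℝ) • (P ∘ Prod.snd)) p μ) +
          (eLpNorm ((108 : ℝ) • R) p μ + eLpNorm ((144 : ℝ) • (R ∘ Prod.swap)) p μ) := by
        rw [hexpand]
        refine (eLpNorm_add_le (by fun_prop) (by fun_prop) hp).trans (add_le_add ?_ ?_) <;>
          exact eLpNorm_add_le (by fun_prop) (by fun_prop) hp
    _ = 91 * eLpNorm P p (stdGaussian E) + 252 * eLpNorm R p μ := by
        simp only [hsmul, hcomp measurePreserving_fst, hcomp measurePreserving_snd, hswap,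
          ← add_mul]
        norm_num

lemma IsParsevalFrame.eLpNorm_cubic_sq_le {c : ι → E} (hc : IsParsevalFrame c) {k : ℕ}
    (hk : k ≠ 0) :
    eLpNorm (fun x => (∑ i, ⟪c i, x⟫ ^ 3) ^ 2) k (stdGaussian E) ≤
      220 * k ^ 3 * Module.finrank ℝ E := by
  rw [eLpNorm_pow _ _ two_ne_zero]
  have hp : (1 : ℝ≥0∞) ≤ 2 * k := by exact_mod_cast (by omega : 1 ≤ 2 * k)
  have hdecouple := eLpNorm_cubic_le_polarized c hp (by finiteness)
  set N := eLpNorm (fun x => ∑ i, ⟪c i, x⟫ ^ 3) (2 * k) (stdGaussian E)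
  refine (ENNReal.mul_le_mul_iff_right (a := 34 ^ 2) (by norm_num) (by finiteness)).1 ?_
  calc 34 ^ 2 * N ^ 2 = (34 * N) ^ 2 := by ring
    _ ≤ 252 ^ 2 * eLpNorm (fun q : E × E => ∑ i, ⟪c i, q.1⟫ ^ 2 * ⟪c i, q.2⟫) (2 * k)
        ((stdGaussian E).prod (stdGaussian E)) ^ 2 := by rw [← mul_pow]; gcongr
    _ ≤ 252 ^ 2 * (k * (4 * k ^ 2 * Module.finrank ℝ E)) := by
        gcongr
        refine (hc.eLpNorm_polarized_cubic_sq_le hk).trans ?_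
        gcongr
        exact hc.eLpNorm_quartic_le hk
    _ = 252 ^ 2 * 4 * (k ^ 3 * Module.finrank ℝ E) := by ring
    _ ≤ 34 ^ 2 * 220 * (k ^ 3 * Module.finrank ℝ E) := by
        gcongr ?_ * _
        norm_num
    _ = 34 ^ 2 * (220 * k ^ 3 * Module.finrank ℝ E) := by ring

end Cubic

/-! ### Tail bounds -/

section Tail

lemma measureReal_lt_le_pow_of_eLpNorm_le {α : Type*} {mα : MeasurableSpace α} {μ : Measure α}
    {f : α → ℝ} (hf : AEStronglyMeasurable f μ) {k : ℕ} (hk : k ≠ 0) {t δ : ℝ} (ht : 0 < t)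
    (hδ : 0 ≤ δ) (hfδ : eLpNorm f k μ ≤ ENNReal.ofReal (δ * t)) :
    μ.real {x | t < f x} ≤ δ ^ k := by
  have hMarkov := mul_meas_ge_le_pow_eLpNorm' μ (p := k) (by exact_mod_cast hk)
    (ENNReal.natCast_ne_top k) hf (ENNReal.ofReal t)
  simp only [ENNReal.toReal_natCast, ENNReal.rpow_natCast] at hMarkov
  refine ENNReal.toReal_le_of_le_ofReal (by positivity) ?_
  refine (ENNReal.mul_le_mul_iff_right (a := ENNReal.ofReal t ^ k)
    (pow_ne_zero k (ENNReal.ofReal_pos.2 ht).ne') (by finiteness)).1 ?_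
  calc ENNReal.ofReal t ^ k * μ {x | t < f x}
      ≤ ENNReal.ofReal t ^ k * μ {x | ENNReal.ofReal t ≤ ‖f x‖ₑ} := by
        gcongr with x
        intro hx
        rw [Real.enorm_of_nonneg (ht.trans hx).le]
        exact ENNReal.ofReal_le_ofReal hx.le
    _ ≤ eLpNorm f k μ ^ k := hMarkov
    _ ≤ ENNReal.ofReal (δ * t) ^ k := by gcongr
    _ = ENNReal.ofReal t ^ k * ENNReal.ofReal (δ ^ k) := by
        rw [mul_comm δ, ENNReal.ofReal_mul ht.le, mul_pow, ENNReal.ofReal_pow hδ]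

/-- Taking `k = ⌊L / 2⌋` makes the Markov ratio `δ = exp ((3 / 2 - L) / k)` at least `1 / 13`. -/
lemma exists_moment_order {L : ℝ} (hL : 2 ≤ L) :
    ∃ k : ℕ, k ≠ 0 ∧ 8 * (k : ℝ) ^ 3 ≤ 13 * (Real.exp ((3 / 2 - L) / k) * L ^ 3) := by
  have hk : 1 ≤ ⌊L / 2⌋₊ := Nat.le_floor (by push_cast; linarith)
  refine ⟨⌊L / 2⌋₊, by omega, ?_⟩
  have hle : (⌊L / 2⌋₊ : ℝ) ≤ L / 2 := Nat.floor_le (by linarith)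
  have hlt : L / 2 < ⌊L / 2⌋₊ + 1 := Nat.lt_floor_add_one _
  set k := ⌊L / 2⌋₊
  have hk' : (1 : ℝ) ≤ k := by exact_mod_cast hk
  have hexp : 1 ≤ 13 * Real.exp ((3 / 2 - L) / k) := by
    have hexponent : -(5 / 2) ≤ (3 / 2 - L) / k := by
      rw [le_div_iff₀ (by linarith)]
      linarith
    have hsq : Real.exp (5 / 2) ^ 2 ≤ 13 ^ 2 := by
      calc Real.exp (5 / 2) ^ 2 = Real.exp 1 ^ 5 := by
            rw [← Real.exp_nat_mul, ← Real.exp_nat_mul]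
            norm_num
        _ ≤ 2.7182818286 ^ 5 := by gcongr; exact Real.exp_one_lt_d9.le
        _ ≤ 13 ^ 2 := by norm_num
    calc 1 = Real.exp (5 / 2) * Real.exp (-(5 / 2)) := by rw [← Real.exp_add]; simp
      _ ≤ 13 * Real.exp ((3 / 2 - L) / k) := by
        gcongr
        exact le_of_pow_le_pow_left₀ two_ne_zero (by norm_num) hsq
  calc 8 * (k : ℝ) ^ 3 ≤ 8 * (L / 2) ^ 3 := by gcongr
    _ = 1 * L ^ 3 := by ring
    _ ≤ 13 * Real.exp ((3 / 2 - L) / k) * L ^ 3 := by gcongr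
    _ = 13 * (Real.exp ((3 / 2 - L) / k) * L ^ 3) := by ring

lemma measureReal_lt_le_exp_of_eLpNorm_le {α : Type*} {mα : MeasurableSpace α} {μ : Measure α}
    {f : α → ℝ} (hf : AEStronglyMeasurable f μ) {C : ℝ≥0} {D L : ℝ} (hD : 0 < D) (hL : 2 ≤ L)
    (hCD : 13 * C ≤ 8 * D) (hfC : ∀ k : ℕ, k ≠ 0 → eLpNorm f k μ ≤ C * k ^ 3) :
    μ.real {x | D * L ^ 3 < f x} ≤ Real.exp (3 / 2 - L) := by
  obtain ⟨k, hk, hkL⟩ := exists_moment_order hL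
  have hexp : Real.exp ((3 / 2 - L) / k) ^ k = Real.exp (3 / 2 - L) := by
    rw [← Real.exp_nat_mul, mul_div_cancel₀ _ (by exact_mod_cast hk)]
  have hratio : C * (k : ℝ) ^ 3 ≤ Real.exp ((3 / 2 - L) / k) * (D * L ^ 3) := by
    have hk3 : (0 : ℝ) < k ^ 3 := by positivity
    nlinarith
  rw [← hexp]
  refine measureReal_lt_le_pow_of_eLpNorm_le hf hk (by positivity) (Real.exp_pos _).le
    (((hfC k hk).trans_eq ?_).trans (ENNReal.ofReal_le_ofReal hratio))
  rw [ENNReal.ofReal_mul C.coe_nonneg, ENNReal.ofReal_coe_nnreal,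
    ENNReal.ofReal_pow (by positivity), ENNReal.ofReal_natCast]

variable {E ι : Type*} [NormedAddCommGroup E] [InnerProductSpace ℝ E] [Fintype ι]
  [FiniteDimensional ℝ E] [Nontrivial E] [MeasurableSpace E] [BorelSpace E] {c : ι → E}

lemma IsParsevalFrame.measureReal_cubic_sq_gt_le (hc : IsParsevalFrame c) {L : ℝ} (hL : 2 ≤ L) :
    (stdGaussian E).real {x | 361 * Module.finrank ℝ E * L ^ 3 < (∑ i, ⟪c i, x⟫ ^ 3) ^ 2} ≤
      Real.exp (3 / 2 - L) := by
  have hd : (0 : ℝ) < Module.finrank ℝ E := by exact_mod_cast Module.finrank_pos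
  refine measureReal_lt_le_exp_of_eLpNorm_le (C := 220 * Module.finrank ℝ E) (by fun_prop)
    (by positivity) hL (by push_cast; linarith) fun k hk =>
      (hc.eLpNorm_cubic_sq_le hk).trans_eq ?_
  push_cast
  ring

lemma IsParsevalFrame.measureReal_quartic_gt_le (hc : IsParsevalFrame c) {L : ℝ} (hL : 2 ≤ L) :
    (stdGaussian E).real {x | 8 * Module.finrank ℝ E * L ^ 3 < ∑ i, ⟪c i, x⟫ ^ 4} ≤
      Real.exp (3 / 2 - L) := by
  have hd : (0 : ℝ) < Module.finrank ℝ E := by exact_mod_cast Module.finrank_pos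
  refine measureReal_lt_le_exp_of_eLpNorm_le (C := 4 * Module.finrank ℝ E) (by fun_prop)
    (by positivity) hL (by push_cast; linarith) fun k hk =>
      (hc.eLpNorm_quartic_le hk).trans ?_
  have hk1 : (1 : ℝ≥0∞) ≤ k := by exact_mod_cast Nat.one_le_iff_ne_zero.2 hk
  calc 4 * (k : ℝ≥0∞) ^ 2 * Module.finrank ℝ E ≤ 4 * k ^ 3 * Module.finrank ℝ E := by
        gcongr
        norm_num
    _ = ((4 * Module.finrank ℝ E : ℝ≥0) : ℝ≥0∞) * k ^ 3 := by push_cast; ring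

lemma IsParsevalFrame.le_measureReal_cubic_quartic_le (hc : IsParsevalFrame c) {L : ℝ}
    (hL : 2 ≤ L) :
    1 - 2 * Real.exp (3 / 2 - L) ≤ (stdGaussian E).real
      {x | (∑ i, ⟪c i, x⟫ ^ 3) ^ 2 ≤ 361 * Module.finrank ℝ E * L ^ 3 ∧
        ∑ i, ⟪c i, x⟫ ^ 4 ≤ 8 * Module.finrank ℝ E * L ^ 3} := by
  set badCubic := {x | 361 * Module.finrank ℝ E * L ^ 3 < (∑ i, ⟪c i, x⟫ ^ 3) ^ 2}
  set badQuartic := {x | 8 * Module.finrank ℝ E * L ^ 3 < ∑ i, ⟪c i, x⟫ ^ 4}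
  have hunion : (stdGaussian E).real (badCubic ∪ badQuartic) ≤ 2 * Real.exp (3 / 2 - L) := by
    rw [two_mul]
    exact (measureReal_union_le _ _).trans
      (add_le_add (hc.measureReal_cubic_sq_gt_le hL) (hc.measureReal_quartic_gt_le hL))
  have hmeas : MeasurableSet (badCubic ∪ badQuartic) :=
    (measurableSet_lt (by fun_prop) (by fun_prop)).union
      (measurableSet_lt (by fun_prop) (by fun_prop))
  have hcompl : (badCubic ∪ badQuartic)ᶜ = {x | (∑ i, ⟪c i, x⟫ ^ 3) ^ 2 ≤
      361 * Module.finrank ℝ E * L ^ 3 ∧ ∑ i, ⟪c i, x⟫ ^ 4 ≤ 8 * Module.finrank ℝ E * L ^ 3} := by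
    ext x
    simp [badCubic, badQuartic]
  rw [← hcompl, probReal_compl_eq_one_sub hmeas]
  linarith

end Tail

/-! ### Local norms under a displacement -/

section Polytope

variable {m n : ℕ} {a : Fin m → EuclideanSpace ℝ (Fin n)} {b : Fin m → ℝ}
  {x : EuclideanSpace ℝ (Fin n)}

/-- The constraint vector `aᵢ / (aᵢᵀ x - bᵢ)`, normalized so that it measures displacements from
`x` relative to the slack of the `i`-th constraint. These are the rows of `S_x⁻¹ A` in the usual
notation for the barrier Hessian `H(x) = Aᵀ S_x⁻² A`. -/
noncomputable def scaledConstraint (a : Fin m → EuclideanSpace ℝ (Fin n)) (b : Fin m → ℝ)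
    (x : EuclideanSpace ℝ (Fin n)) (i : Fin m) : EuclideanSpace ℝ (Fin n) :=
  (⟪a i, x⟫ - b i)⁻¹ • a i

lemma dotProduct_barrierHessian_mulVec (a : Fin m → EuclideanSpace ℝ (Fin n)) (b : Fin m → ℝ)
    (x v : EuclideanSpace ℝ (Fin n)) :
    v.ofLp ⬝ᵥ barrierHessian a b x *ᵥ v.ofLp = ∑ i, ⟪scaledConstraint a b x i, v⟫ ^ 2 := by
  rw [barrierHessian, Matrix.sum_mulVec, dotProduct_sum]
  refine Finset.sum_congr rfl fun i _ => ?_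
  have hinner : ⟪a i, v⟫ = v.ofLp ⬝ᵥ (a i).ofLp := by
    simp [EuclideanSpace.inner_eq_star_dotProduct]
  rw [Matrix.smul_mulVec, Matrix.vecMulVec_mulVec, scaledConstraint, real_inner_smul_left, hinner]
  simp only [dotProduct_smul, smul_eq_mul, MulOpposite.smul_eq_mul_unop, MulOpposite.unop_op,
    dotProduct_comm (a i).ofLp v.ofLp, one_div, ← inv_pow]
  ring

lemma localNorm_sq (a : Fin m → EuclideanSpace ℝ (Fin n)) (b : Fin m → ℝ)
    (x v : EuclideanSpace ℝ (Fin n)) :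
    localNorm a b x v ^ 2 = ∑ i, ⟪scaledConstraint a b x i, v⟫ ^ 2 := by
  rw [localNorm, dotProduct_barrierHessian_mulVec,
    Real.sq_sqrt (Finset.sum_nonneg fun i _ => sq_nonneg _)]

lemma slack_pos_of_mem_interior (hx : x ∈ interior (polytope a b)) {i : Fin m} (hi : a i ≠ 0) :
    0 < ⟪a i, x⟫ - b i := by
  have hopen : IsOpenMap (innerSL ℝ (a i)) :=
    (innerSL ℝ (a i)).isOpenMap_of_ne_zero <| by
      rwa [← norm_ne_zero_iff, innerSL_apply_norm, norm_ne_zero_iff]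
  have himage : innerSL ℝ (a i) '' interior (polytope a b) ⊆ Set.Ioi (b i) := by
    rw [← interior_Ici]
    refine hopen.image_interior_subset _ |>.trans (interior_mono ?_)
    rintro _ ⟨y, hy, rfl⟩
    exact hy i
  exact sub_pos.2 (himage ⟨x, hx, rfl⟩)

lemma mem_interior_of_slack_pos (hx : x ∈ polytope a b) {z : EuclideanSpace ℝ (Fin n)}
    (hz : ∀ i, a i ≠ 0 → 0 < ⟪a i, z⟫ - b i) : z ∈ interior (polytope a b) := by
  refine mem_interior.2 ⟨⋂ i, ⋂ (_ : a i ≠ 0), {y | b i < ⟪a i, y⟫}, fun y hy i => ?_, ?_, ?_⟩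
  · by_cases hi : a i = 0
    · simpa [hi] using hx i
    · exact (Set.mem_iInter₂.1 hy i hi).le
  · exact isOpen_iInter_of_finite fun i => isOpen_iInter_of_finite fun _ =>
      isOpen_lt continuous_const (by fun_prop)
  · exact Set.mem_iInter₂.2 fun i hi => sub_pos.1 (hz i hi)

lemma slack_add (hx : x ∈ interior (polytope a b)) (w : EuclideanSpace ℝ (Fin n)) {i : Fin m}
    (hi : a i ≠ 0) :
    ⟪a i, x + w⟫ - b i = (⟪a i, x⟫ - b i) * (1 + ⟪scaledConstraint a b x i, w⟫) := by
  have hs := slack_pos_of_mem_interior hx hi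
  rw [scaledConstraint, real_inner_smul_left, inner_add_right]
  field_simp
  ring

lemma scaledConstraint_add (hx : x ∈ interior (polytope a b)) (w : EuclideanSpace ℝ (Fin n))
    (i : Fin m) :
    scaledConstraint a b (x + w) i =
      (1 + ⟪scaledConstraint a b x i, w⟫)⁻¹ • scaledConstraint a b x i := by
  by_cases hi : a i = 0
  · simp [scaledConstraint, hi]
  · rw [scaledConstraint, slack_add hx w hi, mul_inv_rev, mul_smul]
    rfl

lemma add_mem_interior_polytope (hx : x ∈ interior (polytope a b))
    {w : EuclideanSpace ℝ (Fin n)} (hw : ∀ i, -1 < ⟪scaledConstraint a b x i, w⟫) :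
    x + w ∈ interior (polytope a b) := by
  refine mem_interior_of_slack_pos (interior_subset hx) fun i hi => ?_
  rw [slack_add hx w hi]
  exact mul_pos (slack_pos_of_mem_interior hx hi) (by linarith [hw i])

lemma div_one_add_sq_sub_sq_le {d : ℝ} (hd : -(1 / 10) ≤ d) :
    (d / (1 + d)) ^ 2 - d ^ 2 ≤ -2 * d ^ 3 + 4 * d ^ 4 := by
  have hpos : 0 < 1 + d := by linarith
  have hremainder : 0 ≤ d ^ 4 * (1 + 6 * d + 4 * d ^ 2) :=
    mul_nonneg (by positivity) (by nlinarith [sq_nonneg d])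
  rw [div_pow, sub_le_iff_le_add, div_le_iff₀ (by positivity)]
  nlinarith

lemma localNorm_add_sq_sub_sq_le (hx : x ∈ interior (polytope a b))
    {w : EuclideanSpace ℝ (Fin n)} (hw : ∀ i, -(1 / 10) ≤ ⟪scaledConstraint a b x i, w⟫) :
    localNorm a b (x + w) w ^ 2 - localNorm a b x w ^ 2 ≤
      -2 * ∑ i, ⟪scaledConstraint a b x i, w⟫ ^ 3 +
        4 * ∑ i, ⟪scaledConstraint a b x i, w⟫ ^ 4 := by
  simp only [localNorm_sq, scaledConstraint_add hx, real_inner_smul_left, ← div_eq_inv_mul,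
    Finset.mul_sum, ← Finset.sum_add_distrib, ← Finset.sum_sub_distrib]
  exact Finset.sum_le_sum fun i _ => div_one_add_sq_sub_sq_le (hw i)

lemma accept_of_cubic_quartic_le (hx : x ∈ interior (polytope a b))
    {w : EuclideanSpace ℝ (Fin n)} {ε σ : ℝ} (hε : 0 ≤ ε) (hε' : ε ≤ 1)
    (hσ : σ ≤ 1 / 400)
    (hcubic : |∑ i, ⟪scaledConstraint a b x i, w⟫ ^ 3| ≤ 19 / 20 * ε * σ)
    (hquartic : ∑ i, ⟪scaledConstraint a b x i, w⟫ ^ 4 ≤ ε / 50 * σ) :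
    x + w ∈ interior (polytope a b) ∧
      localNorm a b (x + w) w ^ 2 - localNorm a b x w ^ 2 ≤ 2 * ε * σ := by
  have hεσ : 0 ≤ ε * σ := by linarith [abs_nonneg (∑ i, ⟪scaledConstraint a b x i, w⟫ ^ 3)]
  have hsmall (i : Fin m) : |⟪scaledConstraint a b x i, w⟫| ≤ 1 / 10 := by
    refine le_of_pow_le_pow_left₀ four_ne_zero (by norm_num) ?_
    calc |⟪scaledConstraint a b x i, w⟫| ^ 4 = ⟪scaledConstraint a b x i, w⟫ ^ 4 :=
          Even.pow_abs (by decide) _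
      _ ≤ ∑ j, ⟪scaledConstraint a b x j, w⟫ ^ 4 :=
          Finset.single_le_sum (f := fun j => ⟪scaledConstraint a b x j, w⟫ ^ 4)
            (fun j _ => by positivity) (Finset.mem_univ i)
      _ ≤ ε / 50 * σ := hquartic
      _ ≤ ε / 50 * (1 / 400) := by gcongr
      _ ≤ 1 / 50 * (1 / 400) := by gcongr
      _ ≤ (1 / 10) ^ 4 := by norm_num
  refine ⟨add_mem_interior_polytope hx fun i => ?_, ?_⟩
  · linarith [neg_le_of_abs_le (hsmall i)]
  · linarith [localNorm_add_sq_sub_sq_le hx fun i => neg_le_of_abs_le (hsmall i),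
      neg_le_of_abs_le hcubic]

end Polytope

/-! ### Whitening -/

section Whitening

lemma sqrt_sq_smul {ι : Type*} [Fintype ι] [DecidableEq ι] {s : ℝ} (hs : 0 ≤ s)
    {M : Matrix ι ι ℝ} (hM : M.PosSemidef) : CFC.sqrt (s ^ 2 • M) = s • CFC.sqrt M := by
  refine CFC.sqrt_unique ?_ (smul_nonneg hs (CFC.sqrt_nonneg M))
  rw [smul_mul_smul_comm, CFC.sqrt_mul_sqrt_self M hM.nonneg, ← sq]

lemma sqrt_inv_mul_mul_sqrt_inv {ι : Type*} [Fintype ι] [DecidableEq ι] {M : Matrix ι ι ℝ}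
    (hM : M.PosDef) : CFC.sqrt M⁻¹ * M * CFC.sqrt M⁻¹ = 1 := by
  refine mul_eq_one_comm.1 ?_
  rw [← mul_assoc, CFC.sqrt_mul_sqrt_self M⁻¹ hM.inv.posSemidef.nonneg,
    Matrix.nonsing_inv_mul _ ((Matrix.isUnit_iff_isUnit_det M).1 hM.isUnit)]

variable {m n : ℕ} {a : Fin m → EuclideanSpace ℝ (Fin n)} {b : Fin m → ℝ}
  {x : EuclideanSpace ℝ (Fin n)}

lemma posSemidef_barrierHessian (a : Fin m → EuclideanSpace ℝ (Fin n)) (b : Fin m → ℝ)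
    (x : EuclideanSpace ℝ (Fin n)) : (barrierHessian a b x).PosSemidef :=
  Matrix.posSemidef_sum _ fun i _ =>
    (Matrix.posSemidef_vecMulVec_self_star (a i).ofLp).smul (by positivity)

lemma posDef_barrierHessian (hspan : Submodule.span ℝ (Set.range a) = ⊤)
    (hx : x ∈ interior (polytope a b)) : (barrierHessian a b x).PosDef := by
  rw [Matrix.posDef_iff_dotProduct_mulVec]
  refine ⟨(posSemidef_barrierHessian a b x).isHermitian, fun v hv => ?_⟩
  have hquad := dotProduct_barrierHessian_mulVec a b x (WithLp.toLp 2 v)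
  rw [star_trivial]
  refine hquad.ge.trans_lt' <|
    (Finset.sum_nonneg fun i _ => sq_nonneg _).lt_of_ne' fun hzero => hv ?_
  have hortho (i : Fin m) : ⟪a i, WithLp.toLp 2 v⟫ = 0 := by
    by_cases hi : a i = 0
    · rw [hi, inner_zero_left]
    · have hterm := (Finset.sum_eq_zero_iff_of_nonneg fun i _ => sq_nonneg _).1 hzero i
        (Finset.mem_univ i)
      rw [sq_eq_zero_iff, scaledConstraint, real_inner_smul_left] at hterm
      exact (mul_eq_zero.1 hterm).resolve_left (inv_ne_zero (slack_pos_of_mem_interior hx hi).ne')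
  have hker : innerSL ℝ (WithLp.toLp 2 v) = 0 :=
    ContinuousLinearMap.coe_injective <| LinearMap.ext_on_range hspan fun i => by
      simpa [real_inner_comm] using hortho i
  have hself : ⟪WithLp.toLp 2 v, WithLp.toLp 2 v⟫ = 0 := congrArg (· (WithLp.toLp 2 v)) hker
  simpa using inner_self_eq_zero.1 hself

/-- The positive square root `H(x)^(-1/2)` of the inverse barrier Hessian, as an operator on
`ℝⁿ`. When `H(x)` is invertible, it carries the Euclidean unit ball onto the unit ball of the
local norm at `x`; otherwise it is `0`, by the convention for `Matrix.inv`. -/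
noncomputable def invSqrtHessian (a : Fin m → EuclideanSpace ℝ (Fin n)) (b : Fin m → ℝ)
    (x : EuclideanSpace ℝ (Fin n)) : EuclideanSpace ℝ (Fin n) →L[ℝ] EuclideanSpace ℝ (Fin n) :=
  Matrix.toEuclideanCLM (𝕜 := ℝ) (CFC.sqrt (barrierHessian a b x)⁻¹)

lemma proposal_eq_map (a : Fin m → EuclideanSpace ℝ (Fin n)) (b : Fin m → ℝ) {r : ℝ}
    (hr : 0 ≤ r) (x : EuclideanSpace ℝ (Fin n)) :
    proposal a b r x = (stdGaussian (EuclideanSpace ℝ (Fin n))).map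
      fun g => x + (r / √n) • invSqrtHessian a b x g := by
  have hvariance : r ^ 2 / n = (r / √n) ^ 2 := by rw [div_pow, Real.sq_sqrt n.cast_nonneg]
  rw [proposal, hvariance, multivariateGaussian,
    sqrt_sq_smul (by positivity) (posSemidef_barrierHessian a b x).inv]
  simp only [map_smul, smul_apply, invSqrtHessian]

lemma isSelfAdjoint_invSqrtHessian (a : Fin m → EuclideanSpace ℝ (Fin n)) (b : Fin m → ℝ)
    (x : EuclideanSpace ℝ (Fin n)) : IsSelfAdjoint (invSqrtHessian a b x) :=
  (CFC.sqrt_nonneg _).isSelfAdjoint.map _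

lemma inner_invSqrtHessian_left (u v : EuclideanSpace ℝ (Fin n)) :
    ⟪invSqrtHessian a b x u, v⟫ = ⟪u, invSqrtHessian a b x v⟫ := by
  rw [← ContinuousLinearMap.adjoint_inner_right, (isSelfAdjoint_invSqrtHessian a b x).adjoint_eq]

lemma isParsevalFrame_invSqrtHessian_scaledConstraint
    (hspan : Submodule.span ℝ (Set.range a) = ⊤) (hx : x ∈ interior (polytope a b)) :
    IsParsevalFrame fun i => invSqrtHessian a b x (scaledConstraint a b x i) := by
  intro v
  have hsymm : (CFC.sqrt (barrierHessian a b x)⁻¹)ᵀ = CFC.sqrt (barrierHessian a b x)⁻¹ :=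
    (CFC.sqrt_nonneg (barrierHessian a b x)⁻¹).isSelfAdjoint
  simp only [inner_invSqrtHessian_left]
  calc ∑ i, ⟪scaledConstraint a b x i, invSqrtHessian a b x v⟫ ^ 2
      = CFC.sqrt (barrierHessian a b x)⁻¹ *ᵥ v.ofLp ⬝ᵥ
          barrierHessian a b x *ᵥ CFC.sqrt (barrierHessian a b x)⁻¹ *ᵥ v.ofLp := by
        rw [← dotProduct_barrierHessian_mulVec, invSqrtHessian, Matrix.ofLp_toEuclideanCLM]
    _ = v.ofLp ⬝ᵥ (CFC.sqrt (barrierHessian a b x)⁻¹ * barrierHessian a b x *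
          CFC.sqrt (barrierHessian a b x)⁻¹) *ᵥ v.ofLp := by
        rw [← Matrix.mulVec_mulVec, ← Matrix.mulVec_mulVec, Matrix.dotProduct_mulVec v.ofLp,
          ← Matrix.mulVec_transpose, hsymm]
    _ = ‖v‖ ^ 2 := by
        rw [sqrt_inv_mul_mul_sqrt_inv (posDef_barrierHessian hspan hx), Matrix.one_mulVec,
          EuclideanSpace.real_norm_sq_eq]
        simp only [dotProduct, sq]

lemma accept_of_whitened_cubic_quartic_le (hn : 1 ≤ n) (hx : x ∈ interior (polytope a b))
    {ε : ℝ} (hε : 0 ≤ ε) (hε' : ε ≤ 1) {r L : ℝ} (hL : 1 ≤ L)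
    (hrL : r ^ 2 * L ^ 3 ≤ (ε / 20) ^ 2) {g : EuclideanSpace ℝ (Fin n)}
    (hcubic : (∑ i, ⟪invSqrtHessian a b x (scaledConstraint a b x i), g⟫ ^ 3) ^ 2 ≤
      361 * n * L ^ 3)
    (hquartic : ∑ i, ⟪invSqrtHessian a b x (scaledConstraint a b x i), g⟫ ^ 4 ≤
      8 * n * L ^ 3) :
    x + (r / √n) • invSqrtHessian a b x g ∈ interior (polytope a b) ∧
      localNorm a b (x + (r / √n) • invSqrtHessian a b x g)
            ((r / √n) • invSqrtHessian a b x g) ^ 2 -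
          localNorm a b x ((r / √n) • invSqrtHessian a b x g) ^ 2 ≤
        2 * ε * (r ^ 2 / n) := by
  have hn' : (1 : ℝ) ≤ n := by exact_mod_cast hn
  have hscale : (r / √n) ^ 2 = r ^ 2 / n := by rw [div_pow, Real.sq_sqrt n.cast_nonneg]
  have hinner (k : ℕ) :
      ∑ i, ⟪scaledConstraint a b x i, (r / √n) • invSqrtHessian a b x g⟫ ^ k =
        (r / √n) ^ k * ∑ i, ⟪invSqrtHessian a b x (scaledConstraint a b x i), g⟫ ^ k := by
    simp only [real_inner_smul_right, mul_pow, ← Finset.mul_sum, inner_invSqrtHessian_left]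
  have hr_sq : r ^ 2 ≤ 1 / 400 := by
    have hL3 : 1 ≤ L ^ 3 := one_le_pow₀ hL
    nlinarith [sq_nonneg r]
  refine accept_of_cubic_quartic_le hx hε hε' ((div_le_self (sq_nonneg r) hn').trans hr_sq) ?_ ?_
  · refine abs_le_of_sq_le_sq ?_ (by positivity)
    rw [hinner, mul_pow]
    calc ((r / √n) ^ 3) ^ 2 *
          (∑ i, ⟪invSqrtHessian a b x (scaledConstraint a b x i), g⟫ ^ 3) ^ 2
        ≤ ((r / √n) ^ 3) ^ 2 * (361 * n * L ^ 3) := by gcongr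
      _ = 361 * (r ^ 2 * L ^ 3) * (r ^ 2 / n) ^ 2 := by
          rw [← pow_mul, mul_comm 3 2, pow_mul, hscale]
          field_simp
      _ ≤ 361 * (ε / 20) ^ 2 * (r ^ 2 / n) ^ 2 := by gcongr
      _ = (19 / 20 * ε * (r ^ 2 / n)) ^ 2 := by ring
  · rw [hinner]
    calc (r / √n) ^ 4 * ∑ i, ⟪invSqrtHessian a b x (scaledConstraint a b x i), g⟫ ^ 4
        ≤ (r / √n) ^ 4 * (8 * n * L ^ 3) := by gcongr
      _ = 8 * (r ^ 2 * L ^ 3) * (r ^ 2 / n) := by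
          rw [show 4 = 2 * 2 from rfl, pow_mul, hscale]
          field_simp
      _ ≤ 8 * (ε / 20) ^ 2 * (r ^ 2 / n) := by gcongr
      _ = ε * (ε / 50) * (r ^ 2 / n) := by ring
      _ ≤ 1 * (ε / 50) * (r ^ 2 / n) := by gcongr
      _ = ε / 50 * (r ^ 2 / n) := by ring

lemma span_range_eq_top_of_isBounded (hK : Bornology.IsBounded (polytope a b))
    (hx : x ∈ polytope a b) : Submodule.span ℝ (Set.range a) = ⊤ := by
  rw [← Submodule.orthogonal_eq_bot_iff, Submodule.eq_bot_iff]
  intro v hv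
  by_contra hv0
  have hline (t : ℝ) : x + t • v ∈ polytope a b := fun i => by
    rw [inner_add_right, real_inner_smul_right,
      hv (a i) (Submodule.subset_span (Set.mem_range_self i)), mul_zero, add_zero]
    exact hx i
  obtain ⟨C, hC⟩ := hK.exists_norm_le
  obtain ⟨t, ht⟩ := exists_gt ((C + ‖x‖) / ‖v‖)
  rw [div_lt_iff₀ (norm_pos_iff.2 hv0)] at ht
  have hnorm : t * ‖v‖ ≤ ‖x + t • v‖ + ‖x‖ := by
    calc t * ‖v‖ ≤ ‖t • v‖ := by rw [norm_smul]; gcongr; exact le_abs_self t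
      _ = ‖x + t • v - x‖ := by rw [add_sub_cancel_left]
      _ ≤ ‖x + t • v‖ + ‖x‖ := norm_sub_le _ _
  linarith [hC _ (hline t)]

end Whitening

section Constants

lemma sq_mul_pow_three_le {r L e : ℝ} (hr : 0 ≤ r) (hL : 0 < L)
    (h : r ≤ e * L ^ (-(3 / 2) : ℝ)) : r ^ 2 * L ^ 3 ≤ e ^ 2 := by
  have hpow : (L ^ (-(3 / 2) : ℝ)) ^ 2 * L ^ 3 = 1 := by
    rw [← Real.rpow_natCast, ← Real.rpow_natCast, ← Real.rpow_mul hL.le, ← Real.rpow_add hL]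
    norm_num
  calc r ^ 2 * L ^ 3 ≤ (e * L ^ (-(3 / 2) : ℝ)) ^ 2 * L ^ 3 := by gcongr
    _ = e ^ 2 * ((L ^ (-(3 / 2) : ℝ)) ^ 2 * L ^ 3) := by ring
    _ = e ^ 2 := by rw [hpow, mul_one]

lemma two_le_log_eleven_div {ε : ℝ} (hε : 0 < ε) (hε' : ε ≤ 1) : 2 ≤ Real.log (11 / ε) := by
  rw [Real.le_log_iff_exp_le (by positivity)]
  calc Real.exp 2 = Real.exp 1 ^ 2 := by rw [← Real.exp_nat_mul]; norm_num
    _ ≤ 2.7182818286 ^ 2 := by gcongr; exact Real.exp_one_lt_d9.le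
    _ ≤ 11 := by norm_num
    _ ≤ 11 / ε := le_div_self (by norm_num) hε hε'

lemma two_mul_exp_sub_log_eleven_div_le {ε : ℝ} (hε : 0 < ε) :
    2 * Real.exp (3 / 2 - Real.log (11 / ε)) ≤ ε := by
  have hexp : Real.exp (3 / 2) ≤ 11 / 2 := by
    refine le_of_pow_le_pow_left₀ two_ne_zero (by norm_num) ?_
    calc Real.exp (3 / 2) ^ 2 = Real.exp 1 ^ 3 := by
          rw [← Real.exp_nat_mul, ← Real.exp_nat_mul]
          norm_num
      _ ≤ 2.7182818286 ^ 3 := by gcongr; exact Real.exp_one_lt_d9.le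
      _ ≤ (11 / 2) ^ 2 := by norm_num
  calc 2 * Real.exp (3 / 2 - Real.log (11 / ε)) = 2 * Real.exp (3 / 2) * (ε / 11) := by
        rw [Real.exp_sub, Real.exp_log (by positivity)]
        field_simp
    _ ≤ 2 * (11 / 2) * (ε / 11) := by gcongr
    _ = ε := by ring

end Constants

end DikinWalk

theorem mainTheorem4_general {m n : ℕ} (hn : 1 ≤ n)
    (a : Fin m → EuclideanSpace ℝ (Fin n)) (b : Fin m → ℝ)
    (hspan : Submodule.span ℝ (Set.range a) = ⊤)
    (x : EuclideanSpace ℝ (Fin n)) (hx : x ∈ interior (DikinWalk.polytope a b))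
    (ε : ℝ) (hε : 0 < ε)
    (r : ℝ) (hr : 0 < r) (hr' : r ≤ ε / 20 * Real.log (11 / ε) ^ (-(3 / 2) : ℝ)) :
    1 - ε ≤ (DikinWalk.proposal a b r x).real
      {z | z ∈ interior (DikinWalk.polytope a b) ∧
        DikinWalk.localNorm a b z (z - x) ^ 2 - DikinWalk.localNorm a b x (z - x) ^ 2
          ≤ 2 * ε * (r ^ 2 / (n : ℝ))} := by
  obtain hε1 | hε1 := le_or_gt 1 ε
  · exact (sub_nonpos.2 hε1).trans measureReal_nonneg
  set L := Real.log (11 / ε)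
  set accepted := {z | z ∈ interior (DikinWalk.polytope a b) ∧ _}
  let propose := fun g => x + (r / √n) • DikinWalk.invSqrtHessian a b x g
  have : Nonempty (Fin n) := ⟨⟨0, hn⟩⟩
  have hL : 2 ≤ L := DikinWalk.two_le_log_eleven_div hε hε1.le
  have hrL : r ^ 2 * L ^ 3 ≤ (ε / 20) ^ 2 :=
    DikinWalk.sq_mul_pow_three_le hr.le (by linarith) hr'
  have hframe := DikinWalk.isParsevalFrame_invSqrtHessian_scaledConstraint hspan hx
  have htail := hframe.le_measureReal_cubic_quartic_le hL
  rw [finrank_euclideanSpace_fin] at htail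
  calc 1 - ε ≤ 1 - 2 * Real.exp (3 / 2 - L) :=
        sub_le_sub_left (DikinWalk.two_mul_exp_sub_log_eleven_div_le hε) 1
    _ ≤ (stdGaussian (EuclideanSpace ℝ (Fin n))).real (propose ⁻¹' accepted) :=
        htail.trans <| measureReal_mono fun g hg => by
          simpa [accepted, propose] using
            DikinWalk.accept_of_whitened_cubic_quartic_le hn hx hε.le hε1.le (by linarith) hrL
              hg.1 hg.2
    _ ≤ (DikinWalk.proposal a b r x).real accepted := by
        rw [DikinWalk.proposal_eq_map a b hr.le x]
        exact ENNReal.toReal_mono (measure_ne_top _ _) (Measure.le_map_apply (by fun_prop) _)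

theorem mainTheorem4 {m n : ℕ} (hn : 1 ≤ n)
    (a : Fin m → EuclideanSpace ℝ (Fin n)) (b : Fin m → ℝ)
    (hK : Bornology.IsBounded (DikinWalk.polytope a b))
    (x : EuclideanSpace ℝ (Fin n)) (hx : x ∈ interior (DikinWalk.polytope a b))
    (ε : ℝ) (hε : 0 < ε) (hε' : ε ≤ 1 / 2)
    (r : ℝ) (hr : 0 < r) (hr' : r ≤ ε / 20 * Real.log (11 / ε) ^ (-(3 / 2) : ℝ)) :
    1 - ε ≤ (DikinWalk.proposal a b r x).real
      {z | z ∈ interior (DikinWalk.polytope a b) ∧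
        DikinWalk.localNorm a b z (z - x) ^ 2 - DikinWalk.localNorm a b x (z - x) ^ 2
          ≤ 2 * ε * (r ^ 2 / (n : ℝ))} :=
  mainTheorem4_general hn a b (DikinWalk.span_range_eq_top_of_isBounded hK (interior_subset hx))
    x hx ε hε r hr hr'
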